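/- Theorem (LP formulation of the LCP with a hidden $Z$-matrix). A real square matrix is a $Z$-matrix if all its off-diagonal entries are non-positive. Let $A\in\mathbb R^{n\times n}$ be a hidden $Z$-matrix with witnesses $X,Y,r,s$, that is, $X,Y\in\mathbb R^{n\times n}$ are $Z$-matrices, $r,s\in\mathbb R^n$ are entrywise non-negative, $AX=Y$, and every entry of $r^TX+s^TY$ is positive. Let $q\in\mathbb R^n$. Write $\mathrm{SOL}(q,A)=\{z\in\mathbb R^n : z\ge 0,\ q+Az\ge 0,\ z^T(q+Az)=0\}$ for the solution set of the linear complementarity problem $\mathrm{LCP}(q,A)$, and likewise in any dimension. Consider the linear program in $(z_1,z_2)\in\mathbb R^n\times\mathbb R^n$ $$\text{minimize } (r+A^Ts)^Tz_1+q^Tz_2\quad\text{subject to}\quad A^Ts+r-A^Tz_2\ge 0,\ \ Az_1+q\ge 0,\ \ z_1,z_2\ge 0 .$$ Then $\mathrm{LCP}(q,A)$ is equivalent to this linear program, in the following sense. 1. $(z_1,z_2)$ is an optimal solution of the linear program if and only if $\begin{pmatrix}z_1\\z_2\end{pmatrix}\in\mathrm{SOL}(\bar q,\bar A)$, where $\bar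 A=\begin{pmatrix}0&-A^T\\A&0\end{pmatrix}$ and $\bar q=\begin{pmatrix}r+A^Ts\\q\end{pmatrix}$. 2. $\mathrm{LCP}(q,A)$ has a solution if and only if the linear program has an optimal solution. 3. If $(z_1,z_2)$ is an optimal solution of the linear program, then $z_1\in\mathrm{SOL}(q,A)$. 4. A solution $z\in\mathrm{SOL}(q,A)$ is the first component of some optimal solution of the linear program if and only if $(r+A^Ts)^Tz\le(r+A^Ts)^Tw$ for all $w\in\mathrm{SOL}(q,A)$. -/

import Mathlib

open scoped Matrix

/-- A real square matrix is a `Z`-matrix if all its off-diagonal entries are non-positive. -/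
def IsZMatrix {ι : Type*} (M : Matrix ι ι ℝ) : Prop :=
  ∀ i j, i ≠ j → M i j ≤ 0

/-- `X, Y, r, s` witness that `A` is a hidden `Z`-matrix: `X, Y` are `Z`-matrices, `r, s ≥ 0`,
`A X = Y`, and every entry of the row vector `rᵀ X + sᵀ Y` is positive. -/
structure IsHiddenZWitness {n : ℕ} (A X Y : Matrix (Fin n) (Fin n) ℝ) (r s : Fin n → ℝ) :
    Prop where
  isZMatrix_X : IsZMatrix X
  isZMatrix_Y : IsZMatrix Y
  r_nonneg : 0 ≤ r
  s_nonneg : 0 ≤ s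
  mul_eq : A * X = Y
  pos : ∀ j, 0 < (r ᵥ* X + s ᵥ* Y) j

/-- The feasible set `FEA(q, A)` of the linear complementarity problem. -/
def lcpFeasible {ι : Type*} [Fintype ι] (q : ι → ℝ) (A : Matrix ι ι ℝ) : Set (ι → ℝ) :=
  {z | 0 ≤ z ∧ 0 ≤ q + A *ᵥ z}

/-- The solution set `SOL(q, A)` of the linear complementarity problem. -/
def lcpSolutions {ι : Type*} [Fintype ι] (q : ι → ℝ) (A : Matrix ι ι ℝ) : Set (ι → ℝ) :=
  {z | z ∈ lcpFeasible q A ∧ z ⬝ᵥ (q + A *ᵥ z) = 0}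

/-- The skew-symmetric block matrix with rows `[0, -Aᵀ]` and `[A, 0]`. -/
def skewBlock {n : ℕ} (A : Matrix (Fin n) (Fin n) ℝ) :
    Matrix (Fin n ⊕ Fin n) (Fin n ⊕ Fin n) ℝ :=
  Matrix.fromBlocks 0 (-Aᵀ) A 0

/-- The feasible set of the linear program in the pair `(z₁, z₂)`. -/
def lpFeasible {n : ℕ} (q : Fin n → ℝ) (A : Matrix (Fin n) (Fin n) ℝ) (r s : Fin n → ℝ) :
    Set ((Fin n → ℝ) × (Fin n → ℝ)) :=
  {z | 0 ≤ Aᵀ *ᵥ s + r - Aᵀ *ᵥ z.2 ∧ 0 ≤ A *ᵥ z.1 + q ∧ 0 ≤ z.1 ∧ 0 ≤ z.2}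

/-- The objective `(r + Aᵀ s)ᵀ z₁ + qᵀ z₂` of the linear program. -/
def lpObjective {n : ℕ} (q : Fin n → ℝ) (A : Matrix (Fin n) (Fin n) ℝ) (r s : Fin n → ℝ)
    (z : (Fin n → ℝ) × (Fin n → ℝ)) : ℝ :=
  (r + Aᵀ *ᵥ s) ⬝ᵥ z.1 + q ⬝ᵥ z.2

/-- The set of optimal solutions (minimizers) of the linear program. -/
def lpOptimal {n : ℕ} (q : Fin n → ℝ) (A : Matrix (Fin n) (Fin n) ℝ) (r s : Fin n → ℝ) :
    Set ((Fin n → ℝ) × (Fin n → ℝ)) :=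
  {z | z ∈ lpFeasible q A r s ∧
    ∀ w ∈ lpFeasible q A r s, lpObjective q A r s z ≤ lpObjective q A r s w}

/-! The linear program is self-dual: skew-symmetry makes its objective the complementarity product
of the block LCP, hence nonnegative on the feasible set. Farkas' lemma shows that a feasible program
attains the value zero (`lcpSolutions_nonempty_of_skew`), so optimal means feasible with objective
zero. Such a pair is complementary in both blocks, and the hidden Z-property (`slack_ne_zero_or`)
then forces `z₁` to be complementary to its own residual `q + A z₁`. -/

/-- **Farkas' lemma** for finitely many linear functionals. -/
theorem farkas_finset {V κ : Type*} [AddCommGroup V] [Module ℝ V] (t : Finset κ) :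
    ∀ (f : κ → V →ₗ[ℝ] ℝ) (g : V →ₗ[ℝ] ℝ), (∀ x, (∀ i ∈ t, 0 ≤ f i x) → 0 ≤ g x) →
      ∃ c : κ → ℝ, (∀ i, 0 ≤ c i) ∧ ∀ x, g x = ∑ i ∈ t, c i * f i x := by
  classical
  induction t using Finset.induction_on with
  | empty =>
    intro f g h
    refine ⟨0, fun _ => le_rfl, fun x => ?_⟩
    have h₁ := h x (by simp)
    have h₂ := h (-x) (by simp)
    rw [map_neg] at h₂
    simp only [Finset.sum_empty]
    linarith
  | insert a t ha ih =>
    intro f g h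
    by_cases hg : ∀ x, (∀ i ∈ t, 0 ≤ f i x) → 0 ≤ g x
    · obtain ⟨c, hc, hgc⟩ := ih f g hg
      refine ⟨Function.update c a 0, fun i => ?_, fun x => ?_⟩
      · rcases eq_or_ne i a with rfl | hi
        · simp
        · simpa [hi] using hc i
      · rw [Finset.sum_insert ha, hgc x, Function.update_self, zero_mul, zero_add]
        refine Finset.sum_congr rfl fun i hi => ?_
        rw [Function.update_of_ne (ne_of_mem_of_not_mem hi ha)]
    · push Not at hg
      obtain ⟨x₀, hx₀, hgx₀⟩ := hg
      have hneg : f a x₀ < 0 := by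
        by_contra! hcon
        refine absurd (h x₀ fun i hi => ?_) hgx₀.not_ge
        rcases Finset.mem_insert.1 hi with rfl | hi
        · exact hcon
        · exact hx₀ i hi
      -- Precompose all functionals with the projection along `x₀` onto the kernel of `f a`; there
      -- the constraint `a` holds trivially.
      obtain ⟨c, hc, hgc⟩ := ih (fun i => f i - (f i x₀ / f a x₀) • f a)
        (g - (g x₀ / f a x₀) • f a) (fun x hx => by
          have hproj : ∀ l : V →ₗ[ℝ] ℝ, (l - (l x₀ / f a x₀) • f a) x =
              l (x - (f a x / f a x₀) • x₀) := fun l => by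
            simp only [LinearMap.sub_apply, LinearMap.smul_apply, map_sub, map_smul, smul_eq_mul]
            ring
          rw [hproj]
          refine h _ fun i hi => ?_
          rcases Finset.mem_insert.1 hi with rfl | hi
          · simp [hneg.ne]
          · rw [← hproj]
            exact hx i hi)
      have hsum : 0 ≤ ∑ i ∈ t, c i * f i x₀ :=
        Finset.sum_nonneg fun i hi => mul_nonneg (hc i) (hx₀ i hi)
      -- Evaluation at `x₀` forces this coefficient of `f a`.
      refine ⟨Function.update c a ((g x₀ - ∑ i ∈ t, c i * f i x₀) / f a x₀),
        fun i => ?_, fun x => ?_⟩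
      · rcases eq_or_ne i a with rfl | hi
        · rw [Function.update_self]
          exact div_nonneg_of_nonpos (by linarith) hneg.le
        · simpa [hi] using hc i
      · have hx := hgc x
        simp only [LinearMap.sub_apply, LinearMap.smul_apply, smul_eq_mul, mul_sub,
          Finset.sum_sub_distrib] at hx
        have hfac : ∑ i ∈ t, c i * (f i x₀ / f a x₀ * f a x) =
            (∑ i ∈ t, c i * f i x₀) / f a x₀ * f a x := by
          rw [Finset.sum_div, Finset.sum_mul]
          exact Finset.sum_congr rfl fun i _ => by ring
        have hupd : ∑ i ∈ t, Function.update c a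
            ((g x₀ - ∑ i ∈ t, c i * f i x₀) / f a x₀) i * f i x = ∑ i ∈ t, c i * f i x :=
          Finset.sum_congr rfl fun i hi => by
            rw [Function.update_of_ne (ne_of_mem_of_not_mem hi ha)]
        rw [Finset.sum_insert ha, Function.update_self, hupd, sub_div, sub_mul]
        linarith

/-- A feasible linear complementarity problem with skew-symmetric matrix is solvable. -/
theorem lcpSolutions_nonempty_of_skew {ι : Type*} [Fintype ι] (q : ι → ℝ) (M : Matrix ι ι ℝ)
    (hM : ∀ x, x ⬝ᵥ M *ᵥ x = 0) (hfeas : (lcpFeasible q M).Nonempty) :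
    (lcpSolutions q M).Nonempty := by
  classical
  by_contra hempty
  obtain ⟨x₀, hx₀, hMx₀⟩ := hfeas
  -- Homogenize with a scale `t`: a point of the cone with `t > 0` would rescale to a solution, so
  -- `-t` is nonnegative on the cone.
  let coord : ι → ((ι → ℝ) × ℝ) →ₗ[ℝ] ℝ := fun i => LinearMap.proj i ∘ₗ LinearMap.fst ℝ _ _
  let slack : ι → ((ι → ℝ) × ℝ) →ₗ[ℝ] ℝ := fun i =>
    LinearMap.proj i ∘ₗ M.mulVecLin ∘ₗ LinearMap.fst ℝ _ _ + q i • LinearMap.snd ℝ _ _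
  let cost : ((ι → ℝ) × ℝ) →ₗ[ℝ] ℝ := -∑ i, q i • coord i
  have hslack : ∀ i x, slack i x = (M *ᵥ x.1) i + q i * x.2 := fun i x => rfl
  have hcost : ∀ x, cost x = -(q ⬝ᵥ x.1) := fun x => by
    simp [cost, coord, dotProduct]
  obtain ⟨c, hc, hgc⟩ := farkas_finset Finset.univ
    (Sum.elim coord (Sum.elim slack fun _ : Unit => cost)) (-LinearMap.snd ℝ _ _) (by
      rintro ⟨x, t⟩ hx
      by_contra! hcon
      have ht : 0 < t := by simpa using hcon
      have h₁ : ∀ i, 0 ≤ x i := fun i => hx (.inl i) (Finset.mem_univ _)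
      have h₂ : ∀ i, 0 ≤ (M *ᵥ x) i + q i * t := fun i => hx (.inr (.inl i)) (Finset.mem_univ _)
      have h₃ : 0 ≤ -(q ⬝ᵥ x) := by
        simpa [hcost] using hx (.inr (.inr ())) (Finset.mem_univ _)
      have hpos : 0 ≤ t⁻¹ • x := fun i => mul_nonneg (inv_nonneg.2 ht.le) (h₁ i)
      have hres : 0 ≤ q + M *ᵥ (t⁻¹ • x) := fun i => by
        have := mul_nonneg (inv_nonneg.2 ht.le) (h₂ i)
        rw [Matrix.mulVec_smul]
        simp only [Pi.zero_apply, Pi.add_apply, Pi.smul_apply, smul_eq_mul]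
        field_simp at this ⊢
        linarith
      refine hempty ⟨t⁻¹ • x, ⟨hpos, hres⟩, le_antisymm ?_ (dotProduct_nonneg_of_nonneg hpos hres)⟩
      rw [dotProduct_add, hM, add_zero, smul_dotProduct, dotProduct_comm, smul_eq_mul]
      exact mul_nonpos_of_nonneg_of_nonpos (inv_nonneg.2 ht.le) (by linarith))
  have key : ∀ x t, -t = (fun i => c (.inl i)) ⬝ᵥ x +
      ((fun i => c (.inr (.inl i))) ⬝ᵥ (M *ᵥ x + t • q) + c (.inr (.inr ())) * -(q ⬝ᵥ x)) := by
    intro x t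
    have := hgc (x, t)
    simpa [hslack, hcost, Fintype.sum_sum_type, dotProduct, coord, mul_comm] using this
  set u : ι → ℝ := fun i => c (.inl i)
  set y : ι → ℝ := fun i => c (.inr (.inl i))
  set θ : ℝ := c (.inr (.inr ()))
  have hu : 0 ≤ u := fun i => hc _
  have hy : 0 ≤ y := fun i => hc _
  have hθ : 0 ≤ θ := hc _
  -- At the multipliers themselves, skewness and cancellation of the `q` terms leave `-θ = u ⬝ᵥ y`.
  have h₁ := key y θ
  rw [dotProduct_add, hM, dotProduct_smul, smul_eq_mul, dotProduct_comm q y] at h₁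
  have hθ0 : θ = 0 := by linarith [dotProduct_nonneg_of_nonneg hu hy]
  have h₂ := key x₀ 1
  rw [hθ0, one_smul, add_comm _ q] at h₂
  linarith [dotProduct_nonneg_of_nonneg hu hx₀, dotProduct_nonneg_of_nonneg hy hMx₀]

section LinearProgram

variable {n : ℕ} (q : Fin n → ℝ) (A : Matrix (Fin n) (Fin n) ℝ) (r s : Fin n → ℝ)

theorem skewBlock_mulVec (z₁ z₂ : Fin n → ℝ) :
    skewBlock A *ᵥ Sum.elim z₁ z₂ = Sum.elim (-(Aᵀ *ᵥ z₂)) (A *ᵥ z₁) := by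
  simp [skewBlock, Matrix.fromBlocks_mulVec, Matrix.neg_mulVec]

theorem dotProduct_skewBlock_mulVec_self (x : Fin n ⊕ Fin n → ℝ) :
    x ⬝ᵥ skewBlock A *ᵥ x = 0 := by
  rw [← Sum.elim_comp_inl_inr x, skewBlock_mulVec, sumElim_dotProduct_sumElim, dotProduct_neg,
    Matrix.mulVec_transpose, dotProduct_comm, ← Matrix.dotProduct_mulVec, neg_add_cancel]

theorem mem_lcpFeasible_skewBlock_iff (z₁ z₂ : Fin n → ℝ) :
    Sum.elim z₁ z₂ ∈ lcpFeasible (Sum.elim (r + Aᵀ *ᵥ s) q) (skewBlock A) ↔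
      (z₁, z₂) ∈ lpFeasible q A r s := by
  simp only [lcpFeasible, lpFeasible, Set.mem_ofPred_eq, skewBlock_mulVec, Pi.le_def, Sum.forall,
    Pi.zero_apply, Pi.add_apply, Pi.sub_apply, Pi.neg_apply, Sum.elim_inl, Sum.elim_inr]
  have h₁ : ∀ i, r i + (Aᵀ *ᵥ s) i + -(Aᵀ *ᵥ z₂) i = (Aᵀ *ᵥ s) i + r i - (Aᵀ *ᵥ z₂) i :=
    fun i => by ring
  simp only [h₁, add_comm (q _)]
  tauto

theorem dotProduct_skewBlock_residual (z₁ z₂ : Fin n → ℝ) :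
    Sum.elim z₁ z₂ ⬝ᵥ (Sum.elim (r + Aᵀ *ᵥ s) q + skewBlock A *ᵥ Sum.elim z₁ z₂) =
      lpObjective q A r s (z₁, z₂) := by
  rw [dotProduct_add, dotProduct_skewBlock_mulVec_self, add_zero, sumElim_dotProduct_sumElim,
    lpObjective, dotProduct_comm z₁, dotProduct_comm z₂]

theorem mem_lcpSolutions_skewBlock_iff (z₁ z₂ : Fin n → ℝ) :
    Sum.elim z₁ z₂ ∈ lcpSolutions (Sum.elim (r + Aᵀ *ᵥ s) q) (skewBlock A) ↔
      (z₁, z₂) ∈ lpFeasible q A r s ∧ lpObjective q A r s (z₁, z₂) = 0 := by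
  rw [lcpSolutions, Set.mem_ofPred_eq, mem_lcpFeasible_skewBlock_iff, dotProduct_skewBlock_residual]

/-- Weak duality. -/
theorem lpObjective_nonneg {z : (Fin n → ℝ) × (Fin n → ℝ)} (hz : z ∈ lpFeasible q A r s) :
    0 ≤ lpObjective q A r s z := by
  rw [← dotProduct_skewBlock_residual q A r s z.1 z.2]
  have h := (mem_lcpFeasible_skewBlock_iff q A r s z.1 z.2).2 hz
  exact dotProduct_nonneg_of_nonneg h.1 h.2

/-- Strong duality. -/
theorem exists_lpObjective_eq_zero (h : (lpFeasible q A r s).Nonempty) :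
    ∃ z ∈ lpFeasible q A r s, lpObjective q A r s z = 0 := by
  obtain ⟨⟨z₁, z₂⟩, hz⟩ := h
  obtain ⟨x, hx⟩ := lcpSolutions_nonempty_of_skew _ _ (dotProduct_skewBlock_mulVec_self A)
    ⟨_, (mem_lcpFeasible_skewBlock_iff q A r s z₁ z₂).2 hz⟩
  rw [← Sum.elim_comp_inl_inr x, mem_lcpSolutions_skewBlock_iff] at hx
  exact ⟨_, hx⟩

theorem mem_lpOptimal_iff (z : (Fin n → ℝ) × (Fin n → ℝ)) :
    z ∈ lpOptimal q A r s ↔ z ∈ lpFeasible q A r s ∧ lpObjective q A r s z = 0 := by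
  constructor
  · rintro ⟨hz, hmin⟩
    obtain ⟨w, hw, hw0⟩ := exists_lpObjective_eq_zero q A r s ⟨z, hz⟩
    exact ⟨hz, le_antisymm (hw0 ▸ hmin w hw) (lpObjective_nonneg q A r s hz)⟩
  · rintro ⟨hz, h0⟩
    exact ⟨hz, fun w hw => h0 ▸ lpObjective_nonneg q A r s hw⟩

variable {q A r s}

/-- The multiplier `s` extends every feasible point of the LCP to one of the linear program. -/
theorem mem_lpFeasible_of_mem_lcpFeasible (hr : 0 ≤ r) (hs : 0 ≤ s) {z : Fin n → ℝ}
    (hz : z ∈ lcpFeasible q A) : (z, s) ∈ lpFeasible q A r s :=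
  ⟨by simpa using hr, by simpa [add_comm] using hz.2, hz.1, hs⟩

theorem mem_lcpFeasible_of_mem_lpFeasible {z : (Fin n → ℝ) × (Fin n → ℝ)}
    (hz : z ∈ lpFeasible q A r s) : z.1 ∈ lcpFeasible q A :=
  ⟨hz.2.2.1, by simpa [add_comm] using hz.2.1⟩

theorem lpOptimal_nonempty_of_mem_lcpFeasible (hr : 0 ≤ r) (hs : 0 ≤ s) {z : Fin n → ℝ}
    (hz : z ∈ lcpFeasible q A) : (lpOptimal q A r s).Nonempty := by
  obtain ⟨w, hw⟩ := exists_lpObjective_eq_zero q A r s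
    ⟨_, mem_lpFeasible_of_mem_lcpFeasible hr hs hz⟩
  exact ⟨w, (mem_lpOptimal_iff q A r s w).2 hw⟩

/-- The zero of `u` removes the diagonal entry, the only one that may be positive. -/
theorem IsZMatrix.vecMul_apply_nonpos {ι : Type*} [Fintype ι] {M : Matrix ι ι ℝ}
    (hM : IsZMatrix M) {u : ι → ℝ} (hu : 0 ≤ u) {i : ι} (hi : u i = 0) : (u ᵥ* M) i ≤ 0 := by
  refine Finset.sum_nonpos fun j _ => ?_
  rcases eq_or_ne j i with rfl | hj
  · simp [hi]
  · exact mul_nonpos_of_nonneg_of_nonpos (hu j) (hM j i hj)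

/-- For a hidden `Z`-matrix, a dual variable and its slack never vanish simultaneously. -/
theorem IsHiddenZWitness.slack_ne_zero_or {X Y : Matrix (Fin n) (Fin n) ℝ}
    (hA : IsHiddenZWitness A X Y r s) {y : Fin n → ℝ} (hy : 0 ≤ y)
    (hu : 0 ≤ Aᵀ *ᵥ s + r - Aᵀ *ᵥ y) (i : Fin n) :
    (Aᵀ *ᵥ s + r - Aᵀ *ᵥ y) i ≠ 0 ∨ y i ≠ 0 := by
  by_contra! hcon
  have h₁ := hA.isZMatrix_X.vecMul_apply_nonpos hu hcon.1
  have h₂ := hA.isZMatrix_Y.vecMul_apply_nonpos hy hcon.2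
  -- Since `A X = Y`, the slack times `X` contributes `(s - y)ᵀ Y`, which cancels `y`.
  have heq : (Aᵀ *ᵥ s + r - Aᵀ *ᵥ y) ᵥ* X + y ᵥ* Y = r ᵥ* X + s ᵥ* Y := by
    simp only [Matrix.mulVec_transpose, Matrix.sub_vecMul, Matrix.add_vecMul, Matrix.vecMul_vecMul,
      hA.mul_eq]
    abel
  have h₃ := hA.pos i
  rw [← heq, Pi.add_apply] at h₃
  linarith

theorem IsHiddenZWitness.mem_lcpSolutions_of_mem_lpOptimal {X Y : Matrix (Fin n) (Fin n) ℝ}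
    (hA : IsHiddenZWitness A X Y r s) {z : (Fin n → ℝ) × (Fin n → ℝ)}
    (hz : z ∈ lpOptimal q A r s) : z.1 ∈ lcpSolutions q A := by
  obtain ⟨hf, h0⟩ := (mem_lpOptimal_iff q A r s z).1 hz
  have hfl := mem_lcpFeasible_of_mem_lpFeasible hf
  obtain ⟨hu, -, hz₁, hz₂⟩ := hf
  have hcomp : z.1 ⬝ᵥ (Aᵀ *ᵥ s + r - Aᵀ *ᵥ z.2) + z.2 ⬝ᵥ (q + A *ᵥ z.1) = 0 := by
    rw [← h0, lpObjective, dotProduct_sub, dotProduct_add z.2, Matrix.mulVec_transpose A z.2,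
      dotProduct_comm z.1 (z.2 ᵥ* A), ← Matrix.dotProduct_mulVec, add_comm r, dotProduct_comm z.1,
      dotProduct_comm z.2 q]
    ring
  have hn₁ := dotProduct_nonneg_of_nonneg hz₁ hu
  have hn₂ := dotProduct_nonneg_of_nonneg hz₂ hfl.2
  have hc₁ : z.1 ⬝ᵥ (Aᵀ *ᵥ s + r - Aᵀ *ᵥ z.2) = 0 := by linarith
  have hc₂ : z.2 ⬝ᵥ (q + A *ᵥ z.1) = 0 := by linarith
  have hi₁ := (Finset.sum_eq_zero_iff_of_nonneg fun i _ => mul_nonneg (hz₁ i) (hu i)).1 hc₁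
  have hi₂ := (Finset.sum_eq_zero_iff_of_nonneg fun i _ => mul_nonneg (hz₂ i) (hfl.2 i)).1 hc₂
  refine ⟨hfl, Finset.sum_eq_zero fun i hi => ?_⟩
  rcases hA.slack_ne_zero_or hz₂ hu i with h | h
  · rw [(mul_eq_zero.1 (hi₁ i hi)).resolve_right h, zero_mul]
  · rw [(mul_eq_zero.1 (hi₂ i hi)).resolve_left h, mul_zero]

end LinearProgram

theorem mainTheorem9 {n : ℕ} (A X Y : Matrix (Fin n) (Fin n) ℝ) (r s : Fin n → ℝ)
    (hA : IsHiddenZWitness A X Y r s) (q : Fin n → ℝ) :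
    -- the LP and the skew-symmetric LCP have the same solutions
    (∀ z₁ z₂ : Fin n → ℝ, (z₁, z₂) ∈ lpOptimal q A r s ↔
      Sum.elim z₁ z₂ ∈ lcpSolutions (Sum.elim (r + Aᵀ *ᵥ s) q) (skewBlock A)) ∧
    -- LCP(q, A) is solvable exactly when the LP is
    ((lcpSolutions q A).Nonempty ↔ (lpOptimal q A r s).Nonempty) ∧
    -- every optimal solution of the LP solves LCP(q, A)
    (∀ z₁ z₂ : Fin n → ℝ, (z₁, z₂) ∈ lpOptimal q A r s → z₁ ∈ lcpSolutions q A) ∧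
    -- a solution of LCP(q, A) comes from the LP iff it is cheapest among all solutions
    (∀ z ∈ lcpSolutions q A, (∃ z₂ : Fin n → ℝ, (z, z₂) ∈ lpOptimal q A r s) ↔
      ∀ w ∈ lcpSolutions q A, (r + Aᵀ *ᵥ s) ⬝ᵥ z ≤ (r + Aᵀ *ᵥ s) ⬝ᵥ w) := by
  refine ⟨fun z₁ z₂ => ?_, ⟨?_, ?_⟩, fun z₁ z₂ hz => hA.mem_lcpSolutions_of_mem_lpOptimal hz,
    fun z hz => ⟨?_, fun hmin => ?_⟩⟩
  · rw [mem_lcpSolutions_skewBlock_iff, mem_lpOptimal_iff]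
  · rintro ⟨z, hz⟩
    exact lpOptimal_nonempty_of_mem_lcpFeasible hA.r_nonneg hA.s_nonneg hz.1
  · rintro ⟨z, hz⟩
    exact ⟨_, hA.mem_lcpSolutions_of_mem_lpOptimal hz⟩
  · rintro ⟨z₂, hf, hmin⟩ w hw
    -- The constraints on the two components are independent, so first components can be exchanged.
    have hwf : (w, z₂) ∈ lpFeasible q A r s :=
      ⟨hf.1, by simpa [add_comm] using hw.1.2, hw.1.1, hf.2.2.2⟩
    simpa [lpObjective] using hmin _ hwf
  · obtain ⟨⟨w₁, w₂⟩, hw⟩ :=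
      lpOptimal_nonempty_of_mem_lcpFeasible hA.r_nonneg hA.s_nonneg hz.1
    have hle := hmin w₁ (hA.mem_lcpSolutions_of_mem_lpOptimal hw)
    obtain ⟨hf, hopt⟩ := hw
    refine ⟨w₂, ⟨hf.1, by simpa [add_comm] using hz.1.2, hz.1.1, hf.2.2.2⟩,
      fun v hv => le_trans ?_ (hopt v hv)⟩
    simpa [lpObjective] using hle
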